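/- Let $d\ge 0$ be an integer, let $O\subseteq\mathbb{R}^d$ be open, $D\subseteq\partial O$, $p\in(0,\infty)$, $s\in(0,1)$, and put $N:=\partial O\setminus D$. For $E\subseteq\mathbb{R}^d$ write $\mathrm{dist}_E(x)$ for the Euclidean distance of $x$ to $E$, with $\mathrm{dist}_\emptyset=\infty$. For $U\in\{O,\mathbb{R}^d\}$ let $W^{s,p}_D(U)$ be the space of (classes of a.e. equal, real- or complex-valued) functions $f\in L^p(U)$ for which $$[f]_{W^{s,p}(U)}:=\Bigl(\iint_{x,y\in U,\ |x-y|<1}\frac{|f(x)-f(y)|^p}{|x-y|^{sp+d}}\,dy\,dx\Bigr)^{1/p}\quad\text{and}\quad \|f\|_{L^p(U,\mathrm{dist}_D^{-sp})}:=\Bigl(\int_U |f(x)|^p\,\mathrm{dist}_D(x)^{-sp}\,dx\Bigr)^{1/p}$$ are finite, with the (quasi-)norm $\|f\|_{W^{s,p}_D(U)}:=\|f\|_{L^p(U)}+[f]_{W^{s,p}(U)}+\|f\|_{L^p(U,\mathrm{dist}_D^{-sp})}$. (Conventions: $\infty^{-sp}=0$, $0^{-sp}=\infty$, $0\cdot\infty=0$.)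 Suppose that $W^{s,p}_D(O)$ admits whole-space extensions, that is, there are a (not necessarily linear) mapping $\mathrm{Ext}:W^{s,p}_D(O)\to W^{s,p}_D(\mathbb{R}^d)$ and a constant $C<\infty$ such that, for all $f\in W^{s,p}_D(O)$, $\mathrm{Ext} f=f$ a.e. on $O$ and $\|\mathrm{Ext} f\|_{W^{s,p}_D(\mathbb{R}^d)}\le C\|f\|_{W^{s,p}_D(O)}$. Then $O$ satisfies the degenerate interior thickness condition in $N$: there is a constant $c>0$ such that $$|\mathrm{B}(x,r)\cap O|\ \ge\ c\,|\mathrm{B}(x,r)|\qquad\text{for all }x\in N\text{ and all }r\le\min\bigl(1,\mathrm{dist}_{\partial O\setminus N}(x)\bigr),$$ where $\mathrm{B}(x,r)$ is the open Euclidean ball and $|\cdot|$ is Lebesgue measure. -/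

import Mathlib

open MeasureTheory Set Metric
open scoped ENNReal NNReal

noncomputable section

namespace FracSobolev

variable {𝕜 : Type*} [RCLike 𝕜] {d : ℕ}

/-- The truncated Gagliardo seminorm of `f` on `O`:
`(∬_{x, y ∈ O, |x - y| < 1} |f x - f y| ^ p / |x - y| ^ (s p + d) dy dx) ^ (1 / p)`. -/
def seminorm (O : Set (EuclideanSpace ℝ (Fin d))) (s p : ℝ)
    (f : EuclideanSpace ℝ (Fin d) → 𝕜) : ℝ≥0∞ :=
  (∫⁻ x in O, ∫⁻ y in O ∩ ball x 1,
    ‖f x - f y‖ₑ ^ p / edist x y ^ (s * p + d)) ^ (1 / p)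

/-- The fractional Hardy term `‖f‖_{L^p(O, dist_D^{-sp})}`. The distance is extended-valued, so that
the distance to the empty set is `∞` and the weight is then `0`. Where `dist_D` vanishes the weight
is `∞`, with `0 * ∞ = 0`. -/
def hardyNorm (O D : Set (EuclideanSpace ℝ (Fin d))) (s p : ℝ)
    (f : EuclideanSpace ℝ (Fin d) → 𝕜) : ℝ≥0∞ :=
  (∫⁻ x in O, ‖f x‖ₑ ^ p * infEDist x D ^ (-(s * p))) ^ (1 / p)

/-- The (quasi-)norm of `W^{s,p}_D(O) = W^{s,p}(O) ∩ L^p(O, dist_D^{-sp})`. -/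
def wNorm (O D : Set (EuclideanSpace ℝ (Fin d))) (s p : ℝ)
    (f : EuclideanSpace ℝ (Fin d) → 𝕜) : ℝ≥0∞ :=
  eLpNorm f (ENNReal.ofReal p) (volume.restrict O) + seminorm O s p f + hardyNorm O D s p f

/-- The space `W^{s,p}_D(O) = W^{s,p}(O) ∩ L^p(O, dist_D^{-sp})`, consisting of classes of functions
on `O` modulo equality almost everywhere on `O`. -/
def WspD (𝕜 : Type*) [RCLike 𝕜] (O D : Set (EuclideanSpace ℝ (Fin d))) (s p : ℝ) :
    Set (EuclideanSpace ℝ (Fin d) →ₘ[volume.restrict O] 𝕜) :=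
  {f | MemLp f (ENNReal.ofReal p) (volume.restrict O) ∧
    seminorm O s p f < ∞ ∧ hardyNorm O D s p f < ∞}

/-- `W^{s,p}_D(O)` admits whole-space extensions: there is a bounded, possibly nonlinear, mapping
`W^{s,p}_D(O) → W^{s,p}_D(ℝ^d)` that sends each function to an extension of it. -/
def AdmitsWholeSpaceExtensions (𝕜 : Type*) [RCLike 𝕜] (O D : Set (EuclideanSpace ℝ (Fin d)))
    (s p : ℝ) : Prop :=
  ∃ Ext : WspD 𝕜 O D s p → WspD 𝕜 univ D s p,
    (∀ f, (Ext f).1 =ᵐ[volume.restrict O] f.1) ∧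
    ∃ C : ℝ≥0, ∀ f, wNorm univ D s p (Ext f).1 ≤ C * wNorm O D s p f.1

/-- The degenerate interior thickness condition in `N`. The distance is extended-valued, with
`dist_∅ = ∞`; for `r ≤ 0` the ball is empty and the inequality is trivial. -/
def DegenerateInteriorThick (O N : Set (EuclideanSpace ℝ (Fin d))) : Prop :=
  IsOpen O ∧ N ⊆ frontier O ∧
    ∃ c : ℝ≥0, 0 < c ∧ ∀ x ∈ N, ∀ r : ℝ,
      ENNReal.ofReal r ≤ min 1 (infEDist x (frontier O \ N)) →
        c * volume (ball x r) ≤ volume (ball x r ∩ O)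

end FracSobolev

end

/-! Fix `x ∈ N`, let `R = min 1 (dist_D x)`, `m r = |B(x,r) ∩ O|` and `e = s p`. A cutoff equal to
`1` on `B(x,t)` and `0` off `B(x,r)` has norm on `O` at most a constant times `(m r · (r -
t)^(-e))^(1/p)`, and so does its extension `F`, by hypothesis. A lower bound for the norm of `F`
thus forces the gap `r - t` to be small when `m r` is small.

The lower bound lives on a ball `B(x,ρ)` with `r ≤ ρ ≤ R/8`, under the assumption `m r ≤ 2 m t`. If
`|F| ≤ 1/2` on half of it, then `F` has to pass from `1` on `B(x,t) ∩ O` to small values, which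
costs Gagliardo energy (`exists_condenser_bound`). Otherwise `|F| ≥ 1/2` on half of it. If moreover
`m ρ ≥ 2 m r`, the same estimate applies to `1 - |F|`, which is `1` on `O ∩ B(x,ρ) \ B(x,r)`. If
instead `ρ = R/8`, the Hardy term (the `L^p` term when `R = 1`) is large. Each case gives `(r -
t)^(d+e) ≤ C ρ^e m r` (`exists_gap_bound`).

Choosing radii at which `m` is successively halved and summing the gaps as a geometric series
(`rpow_le_of_halving_gaps`) yields `σ^d ≤ C m σ` whenever `m` doubles between `σ` and `ρ ≤ 2σ`, or
`ρ = R/8`. If `m` fails to double between `σ` and `2σ`, the bound at `2σ` passes to `σ`; hence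
induction over the radii `2⁻ⁿ R/8` (`dyadic_density_bound`). -/

/-! ### The Gagliardo kernel of a Lipschitz cutoff -/

section Kernel

variable {d : ℕ}

lemma integrable_min_rpow_mul_rpow (hd : 1 ≤ d) {p e : ℝ} (he : 0 < e) (hep : e < p) :
    Integrable (fun v : EuclideanSpace ℝ (Fin d) =>
      (min 1 ‖v‖) ^ p * ‖v‖ ^ (-(e + d))) := by
  have hp : 0 < p := he.trans hep
  have hm : AEStronglyMeasurable (fun v : EuclideanSpace ℝ (Fin d) =>
      (min 1 ‖v‖) ^ p * ‖v‖ ^ (-(e + d))) volume :=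
    Measurable.aestronglyMeasurable (by fun_prop)
  have hfr : Module.finrank ℝ (EuclideanSpace ℝ (Fin d)) = d := by simp
  have h1 : IntegrableOn (fun v : EuclideanSpace ℝ (Fin d) =>
      (min 1 ‖v‖) ^ p * ‖v‖ ^ (-(e + d))) (ball 0 1) := by
    refine integrableOn_ball_of_norm_le_rpow (C := 1) (α := e + d - p) (by rw [hfr]; exact hd)
      (by rw [hfr]; linarith) (ae_restrict_of_forall_mem measurableSet_ball fun v hv => ?_) hm
    rw [mem_ball_zero_iff] at hv
    rw [Real.norm_of_nonneg (by positivity), min_eq_right hv.le, one_mul]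
    rcases eq_or_lt_of_le (norm_nonneg v) with h0 | h0
    · rw [← h0, Real.zero_rpow hp.ne', zero_mul]
      positivity
    · rw [← Real.rpow_add h0]
      apply le_of_eq
      congr 1
      ring
  have h2 : IntegrableOn (fun v : EuclideanSpace ℝ (Fin d) =>
      (min 1 ‖v‖) ^ p * ‖v‖ ^ (-(e + d))) (ball 0 1)ᶜ := by
    have := (integrable_one_add_norm (E := EuclideanSpace ℝ (Fin d)) (μ := volume) (r := e + d)
      (by rw [hfr]; linarith)).const_mul (2 ^ (e + d))
    refine Integrable.mono' this.integrableOn hm.restrict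
      (ae_restrict_of_forall_mem measurableSet_ball.compl fun v hv => ?_)
    rw [mem_compl_iff, mem_ball_zero_iff, not_lt] at hv
    rw [Real.norm_of_nonneg (by positivity), min_eq_left hv, Real.one_rpow, one_mul]
    have h3 : (2 * ‖v‖) ^ (-(e + d)) ≤ (1 + ‖v‖) ^ (-(e + d)) :=
      Real.rpow_le_rpow_of_nonpos (by positivity) (by linarith) (by
        have : (0:ℝ) ≤ d := by positivity
        linarith)
    rw [Real.mul_rpow (by norm_num) (by positivity)] at h3
    calc ‖v‖ ^ (-(e + d)) = 2 ^ (e + d) * (2 ^ (-(e + d)) * ‖v‖ ^ (-(e + d))) := by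
          rw [← mul_assoc, ← Real.rpow_add (by norm_num)]; simp
      _ ≤ _ := by gcongr
  rw [← integrableOn_univ, ← union_compl_self (ball (0 : EuclideanSpace ℝ (Fin d)) 1)]
  exact h1.union h2

/-- Substituting `v = (x - y) / δ` turns the integral into `δ ^ (-e)` times a fixed one, which
converges at the origin because `e < p` and at infinity because `0 < e`. -/
lemma exists_lintegral_kernel_le (hd : 1 ≤ d) {p e : ℝ} (he : 0 < e) (hep : e < p) :
    ∃ K : ℝ, 1 ≤ K ∧ ∀ δ : ℝ, 0 < δ → ∀ x : EuclideanSpace ℝ (Fin d),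
      ∫⁻ y, ENNReal.ofReal ((min 1 (dist x y / δ)) ^ p * dist x y ^ (-(e + d)))
        ≤ ENNReal.ofReal (K * δ ^ (-e)) := by
  set k : EuclideanSpace ℝ (Fin d) → ℝ := fun v => (min 1 ‖v‖) ^ p * ‖v‖ ^ (-(e + d)) with hk
  have hi : Integrable k := integrable_min_rpow_mul_rpow hd he hep
  refine ⟨max 1 (∫ v, k v), le_max_left _ _, fun δ hδ x => ?_⟩
  have hfr : Module.finrank ℝ (EuclideanSpace ℝ (Fin d)) = d := by simp
  have h1 : ∀ y : EuclideanSpace ℝ (Fin d),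
      (min 1 (dist x y / δ)) ^ p * dist x y ^ (-(e + d))
        = δ ^ (-(e + d)) * k (δ⁻¹ • (x - y)) := by
    intro y
    have : ‖δ⁻¹ • (x - y)‖ = dist x y / δ := by
      rw [norm_smul, Real.norm_of_nonneg (by positivity), dist_eq_norm]; ring
    simp only [hk, this]
    rw [Real.div_rpow dist_nonneg hδ.le]
    have : δ ^ (-(e + d)) ≠ 0 := (Real.rpow_pos_of_pos hδ _).ne'
    field_simp
  simp_rw [h1]
  rw [lintegral_sub_left_eq_self (μ := volume)
    (fun y => ENNReal.ofReal (δ ^ (-(e + d)) * k (δ⁻¹ • y))) x]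
  rw [← ofReal_integral_eq_lintegral_ofReal]
  · apply ENNReal.ofReal_le_ofReal
    rw [integral_const_mul, Measure.integral_comp_inv_smul_of_nonneg _ _ hδ.le, hfr, smul_eq_mul,
      ← mul_assoc, ← Real.rpow_natCast, ← Real.rpow_add hδ, mul_comm]
    have : -(e + d) + (d : ℝ) = -e := by ring
    rw [this]
    gcongr
    exact le_max_right _ _
  · exact (hi.comp_smul (inv_ne_zero hδ.ne')).const_mul _
  · exact Filter.Eventually.of_forall fun y => by positivity

end Kernel

/-! ### Lower bounds for Gagliardo energies -/

section Condenser

variable {d : ℕ}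

lemma volume_real_ball (hd : 1 ≤ d) (x : EuclideanSpace ℝ (Fin d)) {r : ℝ} (hr : 0 ≤ r) :
    volume.real (ball x r)
      = r ^ (d : ℝ) * volume.real (ball (0 : EuclideanSpace ℝ (Fin d)) 1) := by
  have : Nonempty (Fin d) := ⟨⟨0, hd⟩⟩
  rw [measureReal_def, Measure.addHaar_ball _ _ hr, ENNReal.toReal_mul,
    ENNReal.toReal_ofReal (by positivity), finrank_euclideanSpace, Fintype.card_fin,
    Real.rpow_natCast, measureReal_def]

lemma volume_real_unitBall_pos :
    0 < volume.real (ball (0 : EuclideanSpace ℝ (Fin d)) 1) :=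
  ENNReal.toReal_pos (measure_ball_pos _ _ one_pos).ne' measure_ball_lt_top.ne

/-- Lower bound for a Gagliardo energy by the interaction of the points of `S` with sets on which
`g` differs from its value on `S`. -/
lemma mul_le_of_lintegral_le_of_separated {e p h L τ J : ℝ} (hed : 0 < e + d) (hp : 0 < p)
    (hh : 0 < h) (hL : 0 < L) (hJ : 0 ≤ J) (hτ : 0 ≤ τ)
    {g : EuclideanSpace ℝ (Fin d) → ℝ} {U S : Set (EuclideanSpace ℝ (Fin d))}
    {T : EuclideanSpace ℝ (Fin d) → Set (EuclideanSpace ℝ (Fin d))}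
    (hU : volume U ≠ ∞) (hS : MeasurableSet S) (hSU : S ⊆ U)
    (hT : ∀ z ∈ S, MeasurableSet (T z)) (hTU : ∀ z ∈ S, T z ⊆ U)
    (hτT : ∀ z ∈ S, τ ≤ volume.real (T z))
    (hg : ∀ z ∈ S, ∀ y ∈ T z, h ≤ |g z - g y|) (hdist : ∀ z ∈ S, ∀ y ∈ T z, dist z y ≤ L)
    (hI : ∫⁻ z in U, ∫⁻ y in U, ENNReal.ofReal (|g z - g y| ^ p * dist z y ^ (-(e + d)))
      ≤ ENNReal.ofReal J) :
    h ^ p * L ^ (-(e + d)) * τ * volume.real S ≤ J := by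
  have h1 : ENNReal.ofReal (h ^ p * L ^ (-(e + d)) * τ) * volume S ≤ ENNReal.ofReal J := by
    refine le_trans ?_ hI
    refine le_trans ?_ (lintegral_mono_set hSU)
    rw [← setLIntegral_const]
    refine setLIntegral_mono' hS fun z hz => ?_
    refine le_trans ?_ (lintegral_mono_set (hTU z hz))
    calc ENNReal.ofReal (h ^ p * L ^ (-(e + d)) * τ)
        = ENNReal.ofReal (h ^ p * L ^ (-(e + d))) * ENNReal.ofReal τ :=
          ENNReal.ofReal_mul (by positivity)
      _ ≤ ENNReal.ofReal (h ^ p * L ^ (-(e + d))) * volume (T z) := by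
          gcongr
          exact ENNReal.ofReal_le_of_le_toReal (hτT z hz)
      _ = ∫⁻ _ in T z, ENNReal.ofReal (h ^ p * L ^ (-(e + d))) := (setLIntegral_const _ _).symm
      _ ≤ _ := by
          refine setLIntegral_mono' (hT z hz) fun y hy => ENNReal.ofReal_le_ofReal ?_
          have hne : z ≠ y := by
            rintro rfl
            have := hg z hz z hy
            simp only [sub_self, abs_zero] at this
            linarith
          have hpos : 0 < dist z y := dist_pos.2 hne
          exact mul_le_mul (Real.rpow_le_rpow hh.le (hg z hz y hy) hp.le)
            (Real.rpow_le_rpow_of_nonpos hpos (hdist z hz y hy) (by linarith))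
            (by positivity) (by positivity)
  have hSf : volume S ≠ ∞ := ne_top_of_le_ne_top hU (measure_mono hSU)
  rw [← ENNReal.ofReal_toReal hSf, ← ENNReal.ofReal_mul (by positivity),
    ENNReal.ofReal_le_ofReal_iff hJ] at h1
  exact h1

/-- A condenser estimate: if `1 ≤ g` on a set of measure `a` in a ball of radius `ρ` and `g ≤ 1 / 2`
on half of that ball, then the Gagliardo energy of `g` on the doubled ball is bounded below. -/
lemma exists_condenser_bound (hd : 1 ≤ d) {e p : ℝ} (he : 0 < e) (hp : 0 < p) :
    ∃ c : ℝ, 0 < c ∧ ∀ (x : EuclideanSpace ℝ (Fin d)) (ρ a J : ℝ)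
      (g : EuclideanSpace ℝ (Fin d) → ℝ), 0 < ρ → 0 ≤ a → 0 ≤ J → Measurable g →
      a ≤ volume.real {y ∈ ball x ρ | 1 ≤ g y} →
      volume.real (ball x ρ) / 2 ≤ volume.real {y ∈ ball x ρ | g y ≤ 1 / 2} →
      ∫⁻ z in ball x (2 * ρ), ∫⁻ y in ball x (2 * ρ),
        ENNReal.ofReal (|g z - g y| ^ p * dist z y ^ (-(e + d))) ≤ ENNReal.ofReal J →
      c * a ^ (d : ℝ) * ρ ^ (-(e * e)) ≤ J ^ (d + e) := by
  set ω := volume.real (ball (0 : EuclideanSpace ℝ (Fin d)) 1) with hω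
  have hω0 : 0 < ω := volume_real_unitBall_pos
  have hd0 : (0 : ℝ) < d := by exact_mod_cast hd
  set P : ℝ := (1 / 4) ^ p with hP
  have hP0 : 0 < P := by positivity
  set c1 : ℝ := P * 4 ^ (-(e + d)) * (ω / 2) with hc1
  have hc10 : 0 < c1 := by positivity
  clear_value c1 P
  -- The two entries are the constants of the cases `R ≤ ρ` and `ρ < R` below.
  refine ⟨min ((c1 * (ω / 2)) ^ e * (P * (ω / 2)) ^ (d : ℝ))
    ((c1 * (ω / 2)) ^ (d + e) * ω ^ (-(d : ℝ))), by positivity, ?_⟩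
  intro x ρ a J g hρ ha hJ hg hA1 hA0 hI
  rcases ha.eq_or_lt with rfl | ha
  · rw [Real.zero_rpow hd0.ne']
    simp only [mul_zero, zero_mul]
    positivity
  have hsub : ball x ρ ⊆ ball x (2 * ρ) := ball_subset_ball (by linarith)
  set A1 := {y ∈ ball x ρ | 1 ≤ g y} with hA1def
  set A0 := {y ∈ ball x ρ | g y ≤ 1 / 2} with hA0def
  -- The level `3/4` lies at distance `1/4` from both `1` and `1/2`, so `B` can interact with `A0`,
  -- and `A1` with the complement of `B`.
  set B := {y ∈ ball x (2 * ρ) | 3 / 4 ≤ g y} with hBdef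
  have hmA1 : MeasurableSet A1 := measurableSet_ball.inter (measurableSet_le measurable_const hg)
  have hmA0 : MeasurableSet A0 := measurableSet_ball.inter (measurableSet_le hg measurable_const)
  have hmB : MeasurableSet B := measurableSet_ball.inter (measurableSet_le measurable_const hg)
  have hBfin : volume B ≠ ∞ :=
    ne_top_of_le_ne_top measure_ball_lt_top.ne (measure_mono (sep_subset _ _))
  set b := volume.real B with hb
  have hab : a ≤ b := hA1.trans (measureReal_mono
    (fun y hy => ⟨hsub hy.1, by have : 1 ≤ g y := hy.2; show 3 / 4 ≤ g y; linarith⟩) hBfin)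
  have hb0 : 0 < b := ha.trans_le hab
  have haρ : a ≤ ω * ρ ^ (d : ℝ) := by
    refine hA1.trans ((measureReal_mono (sep_subset _ _) measure_ball_lt_top.ne).trans ?_)
    rw [volume_real_ball hd x hρ.le, mul_comm]
  have hρe : ρ ^ (-(e + d)) * ρ ^ (d : ℝ) = ρ ^ (-e) := by
    rw [← Real.rpow_add hρ]; congr 1; ring
  have hJ1 : c1 * b * ρ ^ (-e) ≤ J := by
    have := mul_le_of_lintegral_le_of_separated (h := 1 / 4) (L := 4 * ρ)
      (τ := ω / 2 * ρ ^ (d : ℝ)) (T := fun _ => A0) (by positivity : 0 < e + (d : ℝ)) hp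
      (by norm_num) (by positivity) hJ (by positivity) measure_ball_lt_top.ne hmB (sep_subset _ _)
      (fun _ _ => hmA0) (fun _ _ => (sep_subset _ _).trans hsub)
      (fun _ _ => by rw [volume_real_ball hd x hρ.le] at hA0; linarith)
      (fun z hz y hy => by
        have h1 : 3 / 4 ≤ g z := hz.2
        have h2 : g y ≤ 1 / 2 := hy.2
        exact le_trans (by linarith) (le_abs_self _))
      (fun z hz y hy => by
        have h1 : dist z x < 2 * ρ := hz.1
        have h2 : dist y x < ρ := hy.1
        have := dist_triangle_right z y x
        linarith) hI
    rw [← hP, ← hb] at this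
    refine le_trans (le_of_eq ?_) this
    rw [Real.mul_rpow (by norm_num) hρ.le, hc1, ← hρe]
    ring
  -- A ball of radius `R` has measure `2 b`, so at least measure `b` of it lies outside `B`,
  -- whatever its centre.
  set R : ℝ := (2 * b / ω) ^ (d : ℝ)⁻¹ with hR
  have hR0 : 0 < R := by positivity
  have hRd : R ^ (d : ℝ) = 2 * b / ω := Real.rpow_inv_rpow (by positivity) hd0.ne'
  have hbR : b = ω / 2 * R ^ (d : ℝ) := by rw [hRd]; field_simp
  rcases le_or_gt R ρ with hRρ | hRρ
  · have hJ2 : P * (ω / 2) * a * R ^ (-e) ≤ J := by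
      have := mul_le_of_lintegral_le_of_separated (h := 1 / 4) (L := R)
        (τ := b) (T := fun z => ball z R \ B) (by positivity : 0 < e + (d : ℝ)) hp
        (by norm_num) hR0 hJ hb0.le measure_ball_lt_top.ne hmA1 ((sep_subset _ _).trans hsub)
        (fun _ _ => measurableSet_ball.diff hmB)
        (fun z hz => sdiff_subset.trans (ball_subset_ball' (by
          have : dist z x < ρ := hz.1
          linarith)))
        (fun z _ => by
          have h1 := le_measureReal_sdiff (μ := volume) (s₁ := ball z R) (s₂ := B)
            hBfin
          rw [volume_real_ball hd z hR0.le, ← hω] at h1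
          linarith)
        (fun z hz y hy => by
          have h0 : dist z x < ρ := hz.1
          have h1 : 1 ≤ g z := hz.2
          have h2 : dist y z < R := hy.1
          have h3 : g y < 3 / 4 := by
            by_contra hcon
            refine hy.2 ⟨?_, not_lt.1 hcon⟩
            rw [mem_ball]
            have := dist_triangle y z x
            linarith
          exact le_trans (by linarith) (le_abs_self _))
        (fun z hz y hy => by rw [dist_comm]; exact (mem_ball.1 hy.1).le) hI
      rw [← hP] at this
      refine le_trans ?_ this
      have hRe : R ^ (-(e + d)) * R ^ (d : ℝ) = R ^ (-e) := by
        rw [← Real.rpow_add hR0]; congr 1; ring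
      calc P * (ω / 2) * a * R ^ (-e) = P * R ^ (-(e + d)) * b * a := by
            rw [← hRe, hbR]; ring
        _ ≤ _ := by gcongr
    -- Up to constants, `J` dominates both `a R^(-e)` and `R^d ρ^(-e)`. In the product of the `d`-th
    -- power of the first and the `e`-th power of the second, `R` cancels.
    rw [hbR] at hJ1
    calc _ ≤ (c1 * (ω / 2)) ^ e * (P * (ω / 2)) ^ (d : ℝ) * a ^ (d : ℝ) * ρ ^ (-(e * e)) := by
          gcongr
          exact min_le_left _ _
      _ = (P * (ω / 2) * a * R ^ (-e)) ^ (d : ℝ)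
            * (c1 * (ω / 2 * R ^ (d : ℝ)) * ρ ^ (-e)) ^ e := by
          have h1 : (R ^ (-e)) ^ (d : ℝ) * (R ^ (d : ℝ)) ^ e = 1 := by
            rw [← Real.rpow_mul hR0.le, ← Real.rpow_mul hR0.le, ← Real.rpow_add hR0]
            ring_nf
            simp
          have h2 : c1 * (ω / 2 * R ^ (d : ℝ)) * ρ ^ (-e)
            = c1 * (ω / 2) * R ^ (d : ℝ) * ρ ^ (-e) := by ring
          rw [h2, Real.mul_rpow (x := P * (ω / 2) * a) (by positivity) (by positivity),
            Real.mul_rpow (x := P * (ω / 2)) (y := a) (by positivity) (by positivity),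
            Real.mul_rpow (x := c1 * (ω / 2) * R ^ (d : ℝ)) (by positivity) (by positivity),
            Real.mul_rpow (x := c1 * (ω / 2)) (by positivity) (by positivity),
            ← Real.rpow_mul hρ.le (-e) e, neg_mul]
          linear_combination (-(c1 * (ω / 2)) ^ e * (P * (ω / 2)) ^ (d : ℝ) * a ^ (d : ℝ)
            * ρ ^ (-(e * e))) * h1
      _ ≤ J ^ (d : ℝ) * J ^ e := by gcongr
      _ = J ^ (d + e) := (Real.rpow_add_of_nonneg hJ hd0.le he.le).symm
  · have hJ3 : c1 * (ω / 2) * ρ ^ (d - e) ≤ J := by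
      refine le_trans ?_ hJ1
      rw [hbR, sub_eq_add_neg, Real.rpow_add hρ]
      calc c1 * (ω / 2) * (ρ ^ (d : ℝ) * ρ ^ (-e)) = c1 * (ω / 2 * ρ ^ (d : ℝ)) * ρ ^ (-e) := by
            ring
        _ ≤ _ := by gcongr
    -- Here `B` fills a fixed fraction of the ball of radius `ρ`, and the trivial bound `a ≤ ω ρ^d`
    -- suffices.
    calc _ ≤ (c1 * (ω / 2)) ^ (d + e) * ω ^ (-(d : ℝ)) * (ω * ρ ^ (d : ℝ)) ^ (d : ℝ)
            * ρ ^ (-(e * e)) := by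
          gcongr
          exact min_le_right _ _
      _ = (c1 * (ω / 2) * ρ ^ (d - e)) ^ (d + e) := by
          rw [Real.mul_rpow (x := c1 * (ω / 2)) (by positivity) (by positivity),
            Real.mul_rpow hω0.le (by positivity), ← Real.rpow_mul hρ.le, ← Real.rpow_mul hρ.le,
            Real.rpow_neg hω0.le]
          have h1 : ρ ^ (d * d : ℝ) * ρ ^ (-(e * e)) = ρ ^ ((d - e) * (d + e)) := by
            rw [← Real.rpow_add hρ]; congr 1; ring
          rw [← h1]
          field_simp
      _ ≤ J ^ (d + e) := by gcongr

end Condenser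

/-! ### Summation of gaps between halving radii -/

/-- Take `r n` with `m (r n) = 2⁻ⁿ m σ`. The gap from `r (n + 1)` to `r n` is at most `(A m σ)^(1/q)
l^n` with `l = 2^(-1/q) < 1`, and the gaps add up to `σ`. -/
lemma rpow_le_of_halving_gaps {q A σ : ℝ} (hq : 0 < q) (hA : 0 ≤ A) (hσ : 0 < σ) {m : ℝ → ℝ}
    (hmono : Monotone m) (hcont : Continuous m) (hm0 : m 0 = 0) (hpos : ∀ r, 0 < r → 0 < m r)
    (h : ∀ r t : ℝ, 0 ≤ r → r < t → t ≤ σ → m t ≤ 2 * m r → (t - r) ^ q ≤ A * m t) :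
    σ ^ q ≤ (1 - (2⁻¹ : ℝ) ^ q⁻¹)⁻¹ ^ q * (A * m σ) := by
  set l : ℝ := (2⁻¹ : ℝ) ^ q⁻¹ with hl
  have hl0 : 0 < l := by positivity
  have hl1 : l < 1 := Real.rpow_lt_one (by norm_num) (by norm_num) (by positivity)
  have hlq : l ^ q = 2⁻¹ := Real.rpow_inv_rpow (by norm_num) hq.ne'
  have hmσ := hpos σ hσ
  have hex : ∀ n : ℕ, ∃ r ∈ Icc 0 σ, m r = (2⁻¹ : ℝ) ^ n * m σ ∧ (n = 0 → r = σ) := by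
    intro n
    rcases Nat.eq_zero_or_pos n with rfl | hn
    · exact ⟨σ, ⟨hσ.le, le_rfl⟩, by simp, fun _ => rfl⟩
    · have : (2⁻¹ : ℝ) ^ n * m σ ∈ m '' Icc 0 σ := by
        apply intermediate_value_Icc hσ.le hcont.continuousOn
        rw [hm0]
        exact ⟨by positivity,
          mul_le_of_le_one_left hmσ.le (pow_le_one₀ (by norm_num) (by norm_num))⟩
      obtain ⟨r, hr, hmr⟩ := this
      exact ⟨r, hr, hmr, fun h0 => absurd h0 hn.ne'⟩
  choose r hr hmr hrσ using hex
  set K : ℝ := (A * m σ) ^ q⁻¹ with hK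
  have hK0 : 0 ≤ K := by positivity
  have hstep : ∀ n, r n - r (n + 1) ≤ K * l ^ n := by
    intro n
    rcases le_or_gt (r n) (r (n + 1)) with hle | hlt
    · have : 0 ≤ K * l ^ n := by positivity
      linarith
    · have h1 := h (r (n + 1)) (r n) (hr _).1 hlt (hr _).2 (by
        rw [hmr, hmr, pow_succ]; apply le_of_eq; ring)
      have h2 : (K * l ^ n) ^ q = A * m (r n) := by
        rw [Real.mul_rpow hK0 (by positivity), hK, Real.rpow_inv_rpow (by positivity) hq.ne',
          ← Real.rpow_natCast, ← Real.rpow_mul hl0.le, mul_comm (n : ℝ), Real.rpow_mul hl0.le, hlq,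
          Real.rpow_natCast, hmr]
        ring
      rw [← h2] at h1
      exact (Real.rpow_le_rpow_iff (by linarith) (by positivity) hq).1 h1
  have hsum : ∀ n, r 0 - r n ≤ K * (1 - l)⁻¹ := by
    intro n
    have h1 : r 0 - r n ≤ K * ∑ i ∈ Finset.range n, l ^ i := by
      rw [Finset.mul_sum, ← Finset.sum_range_sub' r n]
      exact Finset.sum_le_sum fun i _ => hstep i
    refine h1.trans (mul_le_mul_of_nonneg_left ?_ hK0)
    rw [← tsum_geometric_of_lt_one hl0.le hl1]
    exact (summable_geometric_of_lt_one hl0.le hl1).sum_le_tsum _ fun i _ => by positivity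
  have hle : σ ≤ K * (1 - l)⁻¹ := by
    -- The radii `r n` tend to `0`, since `m (r n)` eventually drops below `m ε > 0`.
    refine le_of_forall_pos_le_add fun ε hε => ?_
    obtain ⟨n, hn⟩ := exists_pow_lt_of_lt_one (div_pos (hpos ε hε) hmσ)
      (by norm_num : (2⁻¹ : ℝ) < 1)
    rw [lt_div_iff₀ hmσ, ← hmr] at hn
    have h1 := hmono.reflect_lt hn
    have h2 := hsum n
    rw [hrσ 0 rfl] at h2
    linarith
  calc σ ^ q ≤ (K * (1 - l)⁻¹) ^ q := Real.rpow_le_rpow hσ.le hle hq.le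
    _ = _ := by
      rw [Real.mul_rpow hK0 (inv_nonneg.2 (by linarith)), hK,
        Real.rpow_inv_rpow (by positivity) hq.ne', mul_comm]

/-! ### Invariance of the norms under almost everywhere equality -/

namespace FracSobolev

section Congr

variable {𝕜 : Type*} [RCLike 𝕜] {d : ℕ} {O D : Set (EuclideanSpace ℝ (Fin d))} {s p : ℝ}
  {f g : EuclideanSpace ℝ (Fin d) → 𝕜}

lemma seminorm_congr (h : f =ᵐ[volume.restrict O] g) : seminorm O s p f = seminorm O s p g := by
  unfold seminorm
  congr 1
  refine lintegral_congr_ae ?_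
  filter_upwards [h] with x hx
  refine lintegral_congr_ae ?_
  filter_upwards [ae_restrict_of_ae_restrict_of_subset inter_subset_left h] with y hy
  rw [hx, hy]

lemma hardyNorm_congr (h : f =ᵐ[volume.restrict O] g) :
    hardyNorm O D s p f = hardyNorm O D s p g := by
  unfold hardyNorm
  congr 1
  refine lintegral_congr_ae ?_
  filter_upwards [h] with x hx
  rw [hx]

lemma wNorm_congr (h : f =ᵐ[volume.restrict O] g) : wNorm O D s p f = wNorm O D s p g := by
  rw [wNorm, wNorm, seminorm_congr h, hardyNorm_congr h, eLpNorm_congr_ae h]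

end Congr

/-! ### Cutoff functions and their norms -/

section Bump

variable {d : ℕ}

/-- The Lipschitz cutoff function that is `1` on the ball of radius `r - δ` about `x` and vanishes
outside the ball of radius `r`. -/
noncomputable def cutoff (x : EuclideanSpace ℝ (Fin d)) (r δ : ℝ) (y : EuclideanSpace ℝ (Fin d)) : ℝ :=
  max 0 (min 1 ((r - dist y x) / δ))

variable {x y z : EuclideanSpace ℝ (Fin d)} {r δ : ℝ}

lemma continuous_cutoff : Continuous (cutoff x r δ) := by
  unfold cutoff
  fun_prop

lemma cutoff_nonneg : 0 ≤ cutoff x r δ y := le_max_left _ _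

lemma cutoff_le_one : cutoff x r δ y ≤ 1 := max_le zero_le_one (min_le_left _ _)

lemma cutoff_eq_zero (hδ : 0 < δ) (hy : y ∉ ball x r) : cutoff x r δ y = 0 := by
  rw [mem_ball, not_lt] at hy
  exact max_eq_left ((min_le_right _ _).trans (div_nonpos_of_nonpos_of_nonneg (by linarith) hδ.le))

lemma cutoff_eq_one (hδ : 0 < δ) (hy : y ∈ ball x (r - δ)) : cutoff x r δ y = 1 := by
  rw [mem_ball] at hy
  rw [cutoff, min_eq_left, max_eq_right zero_le_one]
  rw [one_le_div hδ]
  linarith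

lemma abs_cutoff_sub_le (hδ : 0 < δ) :
    |cutoff x r δ y - cutoff x r δ z| ≤ min 1 (dist y z / δ) := by
  refine le_min ?_ ?_
  · rw [abs_le]
    constructor <;> linarith [cutoff_nonneg (x := x) (r := r) (δ := δ) (y := y),
      cutoff_nonneg (x := x) (r := r) (δ := δ) (y := z),
      cutoff_le_one (x := x) (r := r) (δ := δ) (y := y),
      cutoff_le_one (x := x) (r := r) (δ := δ) (y := z)]
  · unfold cutoff
    have h1 := abs_max_sub_max_le_max 0 (min 1 ((r - dist y x) / δ)) 0 (min 1 ((r - dist z x) / δ))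
    have h2 := abs_min_sub_min_le_max 1 ((r - dist y x) / δ) 1 ((r - dist z x) / δ)
    have h3 : |(r - dist y x) / δ - (r - dist z x) / δ| ≤ dist y z / δ := by
      rw [← sub_div, abs_div, abs_of_pos hδ]
      gcongr
      rw [sub_sub_sub_cancel_left, abs_sub_comm]
      exact abs_dist_sub_le y z x
    have h4 : |(0 : ℝ) - 0| ≤ dist y z / δ := by rw [sub_self, abs_zero]; positivity
    have h5 : |(1 : ℝ) - 1| ≤ dist y z / δ := by rw [sub_self, abs_zero]; positivity
    exact h1.trans (max_le h4 (h2.trans (max_le h5 h3)))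

/-- Energy bound for functions vanishing outside `S`, in terms of a symmetric kernel. -/
lemma lintegral_lintegral_le_of_symm_kernel {O S : Set (EuclideanSpace ℝ (Fin d))}
    {H k : EuclideanSpace ℝ (Fin d) → EuclideanSpace ℝ (Fin d) → ℝ≥0∞} {A : ℝ≥0∞}
    (hO : MeasurableSet O) (hS : MeasurableSet S) (hkm : Measurable (Function.uncurry k))
    (hksymm : ∀ z y, k z y = k y z) (hHk : ∀ z y, H z y ≤ k z y)
    (hH0 : ∀ z ∈ O, ∀ y ∈ O, z ∉ S → y ∉ S → H z y = 0) (hA : ∀ z, ∫⁻ y, k z y ≤ A) :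
    ∫⁻ z in O, ∫⁻ y in O, H z y ≤ 2 * (A * volume S) := by
  obtain ⟨χ, hχ⟩ : ∃ χ : EuclideanSpace ℝ (Fin d) → ℝ≥0∞, χ = S.indicator 1 := ⟨_, rfl⟩
  have hχm : Measurable χ := hχ ▸ measurable_one.indicator hS
  have hpt : ∀ z ∈ O, ∀ y ∈ O, H z y ≤ χ z * k z y + χ y * k y z := by
    intro z hz y hy
    by_cases hzS : z ∈ S
    · rw [hχ, indicator_of_mem hzS, Pi.one_apply, one_mul]
      exact (hHk z y).trans le_self_add
    by_cases hyS : y ∈ S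
    · rw [hχ, indicator_of_mem hyS, Pi.one_apply, one_mul, hksymm y z]
      exact (hHk z y).trans le_add_self
    rw [hH0 z hz y hy hzS hyS]
    exact zero_le
  have hhalf : ∫⁻ z, ∫⁻ y, χ z * k z y ≤ A * volume S := by
    calc ∫⁻ z, ∫⁻ y, χ z * k z y = ∫⁻ z, χ z * ∫⁻ y, k z y :=
          lintegral_congr fun z => lintegral_const_mul _ hkm.of_uncurry_left
      _ ≤ ∫⁻ z, χ z * A := by
          gcongr with z
          exact hA z
      _ = _ := by rw [lintegral_mul_const _ hχm, hχ, lintegral_indicator_one hS, mul_comm]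
  have hm1 : Measurable (Function.uncurry fun z y => χ z * k z y) :=
    (hχm.comp measurable_fst).mul hkm
  have hm2 : Measurable (Function.uncurry fun z y => χ y * k y z) :=
    hm1.comp measurable_swap
  calc ∫⁻ z in O, ∫⁻ y in O, H z y
      ≤ ∫⁻ z in O, ∫⁻ y in O, (χ z * k z y + χ y * k y z) :=
        setLIntegral_mono' hO fun z hz => setLIntegral_mono' hO fun y hy => hpt z hz y hy
    _ ≤ ∫⁻ z, ∫⁻ y, (χ z * k z y + χ y * k y z) :=
        (setLIntegral_le_lintegral _ _).trans
          (lintegral_mono fun z => setLIntegral_le_lintegral _ _)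
    _ = ∫⁻ z, ((∫⁻ y, χ z * k z y) + ∫⁻ y, χ y * k y z) :=
        lintegral_congr fun z => lintegral_add_left hm1.of_uncurry_left _
    _ = (∫⁻ z, ∫⁻ y, χ z * k z y) + ∫⁻ z, ∫⁻ y, χ y * k y z :=
        lintegral_add_left hm1.lintegral_prod_right _
    _ = (∫⁻ z, ∫⁻ y, χ z * k z y) + ∫⁻ z, ∫⁻ y, χ z * k z y := by
        rw [lintegral_lintegral_swap hm2.aemeasurable]
    _ ≤ A * volume S + A * volume S := add_le_add hhalf hhalf
    _ = _ := (two_mul _).symm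

variable (𝕜 : Type*) [RCLike 𝕜]

lemma enorm_cutoff_le_indicator (hδ : 0 < δ) :
    ‖(cutoff x r δ y : 𝕜)‖ₑ ≤ (ball x r).indicator 1 y := by
  by_cases hy : y ∈ ball x r
  · rw [indicator_of_mem hy, ← ofReal_norm, RCLike.norm_ofReal, abs_of_nonneg cutoff_nonneg]
    exact ENNReal.ofReal_le_one.2 cutoff_le_one
  · simp [cutoff_eq_zero hδ hy]

/-- The bounds on the three parts of the norm of a cutoff function. -/
lemma exists_cutoff_bounds (hd : 1 ≤ d) {s p : ℝ} (hp : 0 < p) (hs0 : 0 < s) (hs1 : s < 1) :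
    ∃ K : ℝ, 0 < K ∧ ∀ (O D : Set (EuclideanSpace ℝ (Fin d))) (x : EuclideanSpace ℝ (Fin d))
      (r δ : ℝ), MeasurableSet O → 0 < δ → δ ≤ 1 →
      (∀ y ∈ ball x r, ENNReal.ofReal δ ≤ infEDist y D) →
      eLpNorm (fun y => (cutoff x r δ y : 𝕜)) (ENNReal.ofReal p) (volume.restrict O)
        ≤ ENNReal.ofReal (K * volume.real (ball x r ∩ O) * δ ^ (-(s * p))) ^ (1 / p) ∧
      seminorm O s p (fun y => (cutoff x r δ y : 𝕜))
        ≤ ENNReal.ofReal (K * volume.real (ball x r ∩ O) * δ ^ (-(s * p))) ^ (1 / p) ∧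
      hardyNorm O D s p (fun y => (cutoff x r δ y : 𝕜))
        ≤ ENNReal.ofReal (K * volume.real (ball x r ∩ O) * δ ^ (-(s * p))) ^ (1 / p) := by
  have he : 0 < s * p := by positivity
  -- Integrability of the kernel near the diagonal, `s p < p`, is where `s < 1` enters.
  obtain ⟨K, hK1, hK⟩ := exists_lintegral_kernel_le hd he
    (by nlinarith : s * p < p)
  refine ⟨2 * K, by positivity, fun O D x r δ hO hδ hδ1 hD => ?_⟩
  set S := ball x r ∩ O with hS
  have hSm : MeasurableSet S := measurableSet_ball.inter hO
  have hSf : volume S ≠ ∞ := ne_top_of_le_ne_top measure_ball_lt_top.ne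
    (measure_mono inter_subset_left)
  have hSr : volume S = ENNReal.ofReal (volume.real S) := (ENNReal.ofReal_toReal hSf).symm
  have hδe : 1 ≤ δ ^ (-(s * p)) := Real.one_le_rpow_of_pos_of_le_one_of_nonpos hδ hδ1 (by linarith)
  have hind : ∀ y, ‖(cutoff x r δ y : 𝕜)‖ₑ ^ p ≤ (ball x r).indicator 1 y := by
    intro y
    calc ‖(cutoff x r δ y : 𝕜)‖ₑ ^ p ≤ ((ball x r).indicator 1 y) ^ p := by
          gcongr
          exact enorm_cutoff_le_indicator 𝕜 hδ
      _ ≤ _ := by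
          by_cases hy : y ∈ ball x r <;> simp [hy, hp]
  refine ⟨?_, ?_, ?_⟩
  · rw [eLpNorm_eq_lintegral_rpow_enorm_toReal (by simpa using hp) ENNReal.ofReal_ne_top,
      ENNReal.toReal_ofReal hp.le]
    gcongr
    calc ∫⁻ y in O, ‖(cutoff x r δ y : 𝕜)‖ₑ ^ p ≤ ∫⁻ y in O, (ball x r).indicator 1 y :=
          lintegral_mono hind
      _ = volume S := by
          rw [lintegral_indicator_one measurableSet_ball, Measure.restrict_apply measurableSet_ball]
      _ ≤ _ := by
          rw [hSr]
          apply ENNReal.ofReal_le_ofReal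
          have : 0 ≤ volume.real S := measureReal_nonneg
          calc volume.real S ≤ (2 * K) * volume.real S :=
                le_mul_of_one_le_left this (by linarith)
            _ ≤ _ := le_mul_of_one_le_right (by positivity) hδe
  · unfold seminorm
    gcongr
    set k : EuclideanSpace ℝ (Fin d) → EuclideanSpace ℝ (Fin d) → ℝ≥0∞ := fun z y =>
      ENNReal.ofReal ((min 1 (dist z y / δ)) ^ p * dist z y ^ (-(s * p + d))) with hk
    have hkm : Measurable (Function.uncurry k) := by
      simp only [hk, Function.uncurry_def]
      fun_prop
    have hksymm : ∀ z y, k z y = k y z := fun z y => by simp only [hk, dist_comm]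
    have hbound : ∀ z y, ‖(cutoff x r δ z : 𝕜) - (cutoff x r δ y : 𝕜)‖ₑ ^ p
        / edist z y ^ (s * p + d) ≤ k z y := by
      intro z y
      rcases eq_or_ne z y with rfl | hzy
      · simp [hp]
      · have hpos : 0 < dist z y := dist_pos.2 hzy
        rw [← RCLike.ofReal_sub, ← ofReal_norm, RCLike.norm_ofReal, edist_dist,
          ENNReal.ofReal_rpow_of_nonneg (abs_nonneg _) hp.le, ENNReal.ofReal_rpow_of_pos hpos,
          ← ENNReal.ofReal_div_of_pos (by positivity), hk]
        apply ENNReal.ofReal_le_ofReal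
        rw [Real.rpow_neg hpos.le, div_eq_mul_inv]
        gcongr
        exact abs_cutoff_sub_le hδ
    have hzero : ∀ z ∈ O, ∀ y ∈ O, z ∉ S → y ∉ S →
        ‖(cutoff x r δ z : 𝕜) - (cutoff x r δ y : 𝕜)‖ₑ ^ p / edist z y ^ (s * p + d) = 0 := by
      intro z hz y hy hzS hyS
      have h1 : cutoff x r δ z = 0 := cutoff_eq_zero hδ fun h => hzS ⟨h, hz⟩
      have h2 : cutoff x r δ y = 0 := cutoff_eq_zero hδ fun h => hyS ⟨h, hy⟩
      simp [h1, h2, hp]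
    -- For an upper bound the truncation `|z - y| < 1` can be dropped.
    refine (lintegral_mono fun z => lintegral_mono_set inter_subset_left).trans ?_
    refine (lintegral_lintegral_le_of_symm_kernel hO hSm hkm hksymm hbound hzero
      (hK δ hδ)).trans (le_of_eq ?_)
    rw [hSr, ← ENNReal.ofReal_mul (by positivity), two_mul,
      ← ENNReal.ofReal_add (by positivity) (by positivity)]
    congr 1
    ring
  · unfold hardyNorm
    gcongr
    calc ∫⁻ y in O, ‖(cutoff x r δ y : 𝕜)‖ₑ ^ p * infEDist y D ^ (-(s * p))
        ≤ ∫⁻ y in O, (ball x r).indicator 1 y * ENNReal.ofReal (δ ^ (-(s * p))) := by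
          refine lintegral_mono fun y => ?_
          by_cases hy : y ∈ ball x r
          · refine mul_le_mul' (hind y) ?_
            rw [← ENNReal.ofReal_rpow_of_pos hδ]
            rw [ENNReal.rpow_neg, ENNReal.rpow_neg, ENNReal.inv_le_inv]
            exact ENNReal.rpow_le_rpow (hD y hy) he.le
          · simp [cutoff_eq_zero hδ hy, hp, hy]
      _ = volume S * ENNReal.ofReal (δ ^ (-(s * p))) := by
          rw [lintegral_mul_const _ (measurable_one.indicator measurableSet_ball),
            lintegral_indicator_one measurableSet_ball, Measure.restrict_apply measurableSet_ball]
      _ ≤ _ := by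
          rw [hSr, ← ENNReal.ofReal_mul (by positivity)]
          apply ENNReal.ofReal_le_ofReal
          have : 0 ≤ volume.real S := measureReal_nonneg
          gcongr
          exact le_mul_of_one_le_left this (by linarith)

end Bump

end FracSobolev

/-! ### Extensions of cutoff functions -/

namespace FracSobolev

variable {𝕜 : Type*} [RCLike 𝕜] {d : ℕ} {O D : Set (EuclideanSpace ℝ (Fin d))} {s p : ℝ}

lemma le_ofReal_of_rpow_le {I : ℝ≥0∞} {C : ℝ≥0} {J : ℝ} (hp : 0 < p)
    (h : I ^ (1 / p) ≤ C * ENNReal.ofReal J ^ (1 / p)) :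
    I ≤ ENNReal.ofReal (C ^ p * J) := by
  have h1 := ENNReal.rpow_le_rpow h hp.le
  rw [ENNReal.mul_rpow_of_nonneg _ _ hp.le, ← ENNReal.rpow_mul, ← ENNReal.rpow_mul,
    one_div_mul_cancel hp.ne', ENNReal.rpow_one, ENNReal.rpow_one] at h1
  rwa [ENNReal.ofReal_mul (by positivity), ← ENNReal.ofReal_rpow_of_nonneg (by positivity) hp.le,
    ENNReal.ofReal_coe_nnreal]

/-- Extensions of cutoff functions: bounds for the three integrals that make up the norm. -/
lemma AdmitsWholeSpaceExtensions.exists_cutoff_extension (hd : 1 ≤ d) (hO : MeasurableSet O)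
    (hp : 0 < p) (hs0 : 0 < s) (hs1 : s < 1) (hext : AdmitsWholeSpaceExtensions 𝕜 O D s p) :
    ∃ K : ℝ, 0 < K ∧ ∀ (x : EuclideanSpace ℝ (Fin d)) (r δ : ℝ), 0 < δ → δ ≤ 1 →
      (∀ y ∈ ball x r, ENNReal.ofReal δ ≤ infEDist y D) →
      ∃ F : EuclideanSpace ℝ (Fin d) → 𝕜, Measurable F ∧
        (∀ᵐ y, y ∈ O → F y = cutoff x r δ y) ∧
        ∫⁻ y, ‖F y‖ₑ ^ p
          ≤ ENNReal.ofReal (K * volume.real (ball x r ∩ O) * δ ^ (-(s * p))) ∧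
        ∫⁻ z, ∫⁻ y in ball z 1, ‖F z - F y‖ₑ ^ p / edist z y ^ (s * p + d)
          ≤ ENNReal.ofReal (K * volume.real (ball x r ∩ O) * δ ^ (-(s * p))) ∧
        ∫⁻ y, ‖F y‖ₑ ^ p * infEDist y D ^ (-(s * p))
          ≤ ENNReal.ofReal (K * volume.real (ball x r ∩ O) * δ ^ (-(s * p))) := by
  obtain ⟨Ext, hExt, C, hC⟩ := hext
  obtain ⟨K, hK0, hK⟩ := exists_cutoff_bounds 𝕜 hd hp hs0 hs1
  -- The `3` counts the parts of the norm; `C + 1` replaces `C` to keep the constant positive.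
  refine ⟨((C + 1) * 3 : ℝ≥0) ^ p * K, by positivity, fun x r δ hδ hδ1 hD => ?_⟩
  obtain ⟨h1, h2, h3⟩ := hK O D x r δ hO hδ hδ1 hD
  set J := K * volume.real (ball x r ∩ O) * δ ^ (-(s * p)) with hJ
  have hJtop : ENNReal.ofReal J ^ (1 / p) < ∞ :=
    ENNReal.rpow_lt_top_of_nonneg (by positivity) ENNReal.ofReal_ne_top
  set f : EuclideanSpace ℝ (Fin d) → 𝕜 := fun y => (cutoff x r δ y : 𝕜) with hf
  have hfm : AEStronglyMeasurable f (volume.restrict O) :=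
    (RCLike.continuous_ofReal.comp continuous_cutoff).aestronglyMeasurable
  have hmk : AEEqFun.mk f hfm =ᵐ[volume.restrict O] f := AEEqFun.coeFn_mk f hfm
  have hmem : AEEqFun.mk f hfm ∈ WspD 𝕜 O D s p := by
    refine ⟨⟨AEEqFun.aestronglyMeasurable _, ?_⟩, ?_, ?_⟩
    · rw [eLpNorm_congr_ae hmk]
      exact h1.trans_lt hJtop
    · rw [seminorm_congr hmk]
      exact h2.trans_lt hJtop
    · rw [hardyNorm_congr hmk]
      exact h3.trans_lt hJtop
  have hw : wNorm univ D s p (Ext ⟨_, hmem⟩).1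
      ≤ ((C + 1) * 3 : ℝ≥0) * ENNReal.ofReal J ^ (1 / p) := by
    refine (hC ⟨_, hmem⟩).trans ?_
    rw [wNorm_congr hmk, ENNReal.coe_mul, mul_assoc]
    refine mul_le_mul' (by simp) ?_
    refine (add_le_add (add_le_add h1 h2) h3).trans (le_of_eq ?_)
    rw [ENNReal.coe_ofNat]
    ring
  refine ⟨(Ext ⟨_, hmem⟩).1, (AEEqFun.stronglyMeasurable _).measurable, ?_, ?_⟩
  · exact (ae_restrict_iff' hO).1 ((hExt ⟨_, hmem⟩).trans hmk)
  have hJ' : ∀ I : ℝ≥0∞, I ^ (1 / p) ≤ wNorm univ D s p (Ext ⟨_, hmem⟩).1 →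
      I ≤ ENNReal.ofReal (((C + 1) * 3 : ℝ≥0) ^ p * K * volume.real (ball x r ∩ O)
        * δ ^ (-(s * p))) := by
    intro I hI
    refine (le_ofReal_of_rpow_le hp (hI.trans hw)).trans (le_of_eq ?_)
    rw [hJ]
    congr 1
    ring
  refine ⟨hJ' _ ?_, hJ' _ ?_, hJ' _ ?_⟩
  · refine le_trans (le_of_eq ?_) (le_self_add.trans le_self_add)
    rw [eLpNorm_eq_lintegral_rpow_enorm_toReal (by simpa using hp) ENNReal.ofReal_ne_top,
      ENNReal.toReal_ofReal hp.le, setLIntegral_univ]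
  · refine le_trans (le_of_eq ?_) (le_add_self.trans le_self_add)
    simp only [seminorm, Measure.restrict_univ, univ_inter]
  · refine le_trans (le_of_eq ?_) le_add_self
    simp only [hardyNorm, Measure.restrict_univ]

end FracSobolev

/-! ### The gap estimate -/

namespace FracSobolev

variable {𝕜 : Type*} [RCLike 𝕜] {d : ℕ} {O D : Set (EuclideanSpace ℝ (Fin d))} {s p : ℝ}

/-- This solves the condenser bound with `a = m / 2` and `J = K m δ^(-e)` for `δ`: the factor `m ^
D` cancels, and an `e`-th root is taken. The exponent `D` is the dimension. -/
lemma rpow_add_le_of_condenser_bound {D e c K m δ ρ : ℝ} (he : 0 < e) (hc : 0 < c)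
    (hK : 0 < K) (hm : 0 < m) (hδ : 0 < δ) (hρ : 0 < ρ)
    (h : c * (m / 2) ^ D * ρ ^ (-(e * e)) ≤ (K * m * δ ^ (-e)) ^ (D + e)) :
    δ ^ (D + e) ≤ (K ^ (D + e) * 2 ^ D / c) ^ e⁻¹ * (ρ ^ e * m) := by
  rw [← Real.rpow_le_rpow_iff (by positivity) (by positivity) he,
    Real.mul_rpow (by positivity) (by positivity), Real.rpow_inv_rpow (by positivity) he.ne',
    Real.mul_rpow (by positivity) hm.le, ← Real.rpow_mul hρ.le, ← Real.rpow_mul hδ.le]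
  rw [Real.mul_rpow (by positivity) (by positivity), Real.mul_rpow hK.le hm.le,
    Real.div_rpow hm.le (by norm_num), ← Real.rpow_mul hδ.le, Real.rpow_add hm,
    Real.rpow_neg hρ.le, show -e * (D + e) = -((D + e) * e) by ring, Real.rpow_neg hδ.le,
    ← div_eq_mul_inv, ← div_eq_mul_inv, div_le_div_iff₀ (by positivity) (by positivity)] at h
  rw [div_mul_eq_mul_div, le_div_iff₀ hc]
  have hmD : 0 < m ^ D := by positivity
  have h2 : (0 : ℝ) < 2 ^ D := by positivity
  have h3 : m ^ D * (δ ^ ((D + e) * e) * c)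
      ≤ m ^ D * (K ^ (D + e) * 2 ^ D * (ρ ^ (e * e) * m ^ e)) := by
    calc m ^ D * (δ ^ ((D + e) * e) * c)
        = 2 ^ D * (c * (m ^ D / 2 ^ D) * δ ^ ((D + e) * e)) := by field_simp
      _ ≤ 2 ^ D * (K ^ (D + e) * (m ^ D * m ^ e) * ρ ^ (e * e)) := by gcongr
      _ = _ := by ring
  exact le_of_mul_le_mul_left h3 hmD

lemma rpow_add_le_of_mass_bound {D e c K m δ ρ : ℝ} (hD : 0 ≤ D) (hc : 0 < c)
    (hδ : 0 < δ) (hδρ : δ ≤ ρ) (h : c * (ρ ^ D * ρ ^ (-e)) ≤ K * m * δ ^ (-e)) :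
    δ ^ (D + e) ≤ K / c * (ρ ^ e * m) := by
  have hρ : 0 < ρ := hδ.trans_le hδρ
  rw [Real.rpow_neg hρ.le, Real.rpow_neg hδ.le, ← div_eq_mul_inv, ← div_eq_mul_inv,
    ← mul_div_assoc, div_le_div_iff₀ (by positivity) (by positivity)] at h
  rw [div_mul_eq_mul_div, le_div_iff₀ hc, Real.rpow_add hδ]
  calc δ ^ D * δ ^ e * c ≤ ρ ^ D * δ ^ e * c := by gcongr
    _ = c * ρ ^ D * δ ^ e := by ring
    _ ≤ K * m * ρ ^ e := h
    _ = _ := by ring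

lemma ofReal_le_enorm_rpow_div (hp : 0 < p) {e : ℝ} {g : EuclideanSpace ℝ (Fin d) → ℝ}
    {F : EuclideanSpace ℝ (Fin d) → 𝕜} (hg : ∀ z y, |g z - g y| ≤ ‖F z - F y‖)
    (z y : EuclideanSpace ℝ (Fin d)) :
    ENNReal.ofReal (|g z - g y| ^ p * dist z y ^ (-e)) ≤ ‖F z - F y‖ₑ ^ p / edist z y ^ e := by
  rcases eq_or_ne z y with rfl | hzy
  · simp [hp.ne']
  · have hpos : 0 < dist z y := dist_pos.2 hzy
    rw [← ofReal_norm, edist_dist, ENNReal.ofReal_rpow_of_nonneg (norm_nonneg _) hp.le,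
      ENNReal.ofReal_rpow_of_pos hpos, ← ENNReal.ofReal_div_of_pos (by positivity)]
    apply ENNReal.ofReal_le_ofReal
    rw [Real.rpow_neg hpos.le, div_eq_mul_inv]
    gcongr
    exact hg z y

/-- Points of the ball of radius `2 ρ` are at distance less than `4 ρ ≤ 1`, so the truncated energy
sees all their interactions. -/
lemma lintegral_ball_energy_le (hp : 0 < p) {e : ℝ} {g : EuclideanSpace ℝ (Fin d) → ℝ}
    {F : EuclideanSpace ℝ (Fin d) → 𝕜} (hg : ∀ z y, |g z - g y| ≤ ‖F z - F y‖)
    {x : EuclideanSpace ℝ (Fin d)} {ρ : ℝ} (hρ : 4 * ρ ≤ 1) :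
    ∫⁻ z in ball x (2 * ρ), ∫⁻ y in ball x (2 * ρ),
        ENNReal.ofReal (|g z - g y| ^ p * dist z y ^ (-e))
      ≤ ∫⁻ z, ∫⁻ y in ball z 1, ‖F z - F y‖ₑ ^ p / edist z y ^ e := by
  refine le_trans ?_ (setLIntegral_le_lintegral (ball x (2 * ρ)) _)
  refine setLIntegral_mono' measurableSet_ball fun z hz => ?_
  refine le_trans (lintegral_mono fun y => ofReal_le_enorm_rpow_div hp hg z y) ?_
  refine lintegral_mono_set (ball_subset_ball' ?_)
  rw [mem_ball, dist_comm] at hz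
  linarith

lemma ofReal_mass_le_lintegral (hp : 0 < p) {F : EuclideanSpace ℝ (Fin d) → 𝕜}
    (hF : Measurable F) {w : EuclideanSpace ℝ (Fin d) → ℝ≥0∞} {W v : ℝ} (hW : 0 ≤ W)
    {B : Set (EuclideanSpace ℝ (Fin d))} (hB : MeasurableSet B)
    (hw : ∀ y ∈ B, ENNReal.ofReal W ≤ w y)
    (hv : v ≤ volume.real {y ∈ B | 1 / 2 ≤ ‖F y‖}) :
    ENNReal.ofReal ((1 / 2) ^ p * W * v) ≤ ∫⁻ y, ‖F y‖ₑ ^ p * w y := by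
  have hm : MeasurableSet {y ∈ B | 1 / 2 ≤ ‖F y‖} :=
    hB.inter (measurableSet_le measurable_const hF.norm)
  calc ENNReal.ofReal ((1 / 2) ^ p * W * v)
      = ENNReal.ofReal ((1 / 2) ^ p * W) * ENNReal.ofReal v := ENNReal.ofReal_mul (by positivity)
    _ ≤ ENNReal.ofReal ((1 / 2) ^ p * W) * volume {y ∈ B | 1 / 2 ≤ ‖F y‖} := by
        gcongr
        exact ENNReal.ofReal_le_of_le_toReal hv
    _ = ∫⁻ _ in {y ∈ B | 1 / 2 ≤ ‖F y‖}, ENNReal.ofReal ((1 / 2) ^ p * W) :=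
        (setLIntegral_const _ _).symm
    _ ≤ ∫⁻ y in {y ∈ B | 1 / 2 ≤ ‖F y‖}, ‖F y‖ₑ ^ p * w y := by
        refine setLIntegral_mono' hm fun y hy => ?_
        have h1 : 1 / 2 ≤ ‖F y‖ := hy.2
        rw [ENNReal.ofReal_mul (by positivity),
          ← ENNReal.ofReal_rpow_of_nonneg (by norm_num) hp.le, ← ofReal_norm]
        gcongr
        exact hw y hy.1
    _ ≤ _ := setLIntegral_le_lintegral _ _

/-- The gap estimate: between the radii `t < r` the measure of `ball x · ∩ O` cannot stay within a
factor `2` unless it is large. -/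
lemma AdmitsWholeSpaceExtensions.exists_gap_bound (hd : 1 ≤ d) (hO : MeasurableSet O)
    (hp : 0 < p) (hs0 : 0 < s) (hs1 : s < 1) (hext : AdmitsWholeSpaceExtensions 𝕜 O D s p) :
    ∃ C : ℝ, 0 < C ∧ ∀ (x : EuclideanSpace ℝ (Fin d)) (R ρ r t : ℝ), R ≤ 1 →
      ENNReal.ofReal R = min 1 (infEDist x D) → 0 ≤ t → t < r → r ≤ ρ → ρ ≤ R / 8 →
      0 < volume.real (ball x r ∩ O) →
      volume.real (ball x r ∩ O) ≤ 2 * volume.real (ball x t ∩ O) →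
      (2 * volume.real (ball x r ∩ O) ≤ volume.real (ball x ρ ∩ O) ∨ ρ = R / 8) →
      (r - t) ^ (d + s * p) ≤ C * (ρ ^ (s * p) * volume.real (ball x r ∩ O)) := by
  have he : 0 < s * p := by positivity
  have hd0 : (0 : ℝ) ≤ d := by positivity
  set e := s * p with he_def
  set ω := volume.real (ball (0 : EuclideanSpace ℝ (Fin d)) 1) with hω
  have hω0 : 0 < ω := volume_real_unitBall_pos
  obtain ⟨K, hK0, hK⟩ := hext.exists_cutoff_extension hd hO hp hs0 hs1
  obtain ⟨c, hc0, hc⟩ := exists_condenser_bound hd he hp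
  -- The `9` comes from `dist_D ≤ R + ρ = 9 ρ` on `ball x ρ` when `ρ = R / 8`.
  set c' : ℝ := (1 / 2) ^ p * 9 ^ (-e) * (ω / 2) with hc'
  have hc'0 : 0 < c' := by positivity
  set C1 := (K ^ (d + e) * 2 ^ (d : ℝ) / c) ^ e⁻¹ with hC1
  have hC10 : 0 < C1 := by positivity
  refine ⟨max C1 (K / c'), lt_max_of_lt_left hC10, ?_⟩
  intro x R ρ r t hR1 hRD ht htr hrρ hρR hm hmt halt
  set m := volume.real (ball x r ∩ O) with hm_def
  have hδ : 0 < r - t := by linarith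
  have hρ0 : 0 < ρ := by linarith
  have hfin : ∀ S : Set (EuclideanSpace ℝ (Fin d)), volume (ball x ρ ∩ S) ≠ ∞ := fun S =>
    ne_top_of_le_ne_top measure_ball_lt_top.ne (measure_mono inter_subset_left)
  -- The ball stays away from `D`: `dist_D y ≥ R - r ≥ 7 r ≥ r - t`.
  have hD : ∀ y ∈ ball x r, ENNReal.ofReal (r - t) ≤ infEDist y D := by
    intro y hy
    by_contra! hcon
    have h1 : ENNReal.ofReal R ≤ infEDist x D := hRD ▸ min_le_right _ _
    have h2 : infEDist x D ≤ infEDist y D + edist x y := infEDist_le_infEDist_add_edist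
    have h3 : edist x y ≤ ENNReal.ofReal r := by
      rw [edist_dist, dist_comm]
      exact ENNReal.ofReal_le_ofReal (mem_ball.1 hy).le
    have h4 : infEDist y D + edist x y < ENNReal.ofReal (r - t) + ENNReal.ofReal r :=
      ENNReal.add_lt_add_of_lt_of_le (ne_top_of_le_ne_top ENNReal.ofReal_ne_top h3) hcon h3
    rw [← ENNReal.ofReal_add hδ.le (by linarith)] at h4
    have h5 := (ENNReal.ofReal_lt_ofReal_iff_of_nonneg (by linarith)).1
      ((h1.trans h2).trans_lt h4)
    linarith
  obtain ⟨F, hFm, hFO, hFp, hFs, hFh⟩ := hK x r (r - t) hδ (by linarith) hD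
  rw [← hm_def] at hFp hFs hFh
  have hJ0 : 0 ≤ K * m * (r - t) ^ (-e) := by positivity
  have hcond : ∀ g : EuclideanSpace ℝ (Fin d) → ℝ, Measurable g →
      (∀ z y, |g z - g y| ≤ ‖F z - F y‖) →
      m / 2 ≤ volume.real {y ∈ ball x ρ | 1 ≤ g y} →
      volume.real (ball x ρ) / 2 ≤ volume.real {y ∈ ball x ρ | g y ≤ 1 / 2} →
      (r - t) ^ (d + e) ≤ max C1 (K / c') * (ρ ^ e * m) := by
    intro g hgm hg h1 h2
    have h3 := hc x ρ (m / 2) _ g hρ0 (by positivity) hJ0 hgm h1 h2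
      ((lintegral_ball_energy_le hp hg (by linarith)).trans hFs)
    refine (rpow_add_le_of_condenser_bound he hc0 hK0 hm hδ hρ0 h3).trans ?_
    gcongr
    exact le_max_left _ _
  -- Either `‖F‖` is small on half of the ball and is compared with its value `1` on `ball x t ∩ O`,
  -- or it is large on half of the ball.
  rcases le_or_gt (volume.real (ball x ρ) / 2) (volume.real {y ∈ ball x ρ | ‖F y‖ ≤ 1 / 2})
    with hhalf | hhalf
  · refine hcond (fun y => ‖F y‖) hFm.norm (fun z y => abs_norm_sub_norm_le _ _) ?_ hhalf
    have h1 : volume.real (ball x t ∩ O) ≤ volume.real {y ∈ ball x ρ | 1 ≤ ‖F y‖} := by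
      refine ENNReal.toReal_mono (hfin _) (measure_mono_ae ?_)
      filter_upwards [hFO] with y hy hyt
      refine ⟨ball_subset_ball (by linarith) hyt.1, ?_⟩
      rw [hy hyt.2, cutoff_eq_one hδ (by rw [sub_sub_cancel]; exact hyt.1)]
      simp
    linarith
  · have hbig : volume.real (ball x ρ) / 2 ≤ volume.real {y ∈ ball x ρ | 1 / 2 ≤ ‖F y‖} := by
      have h1 : volume.real (ball x ρ) ≤ volume.real
          ({y ∈ ball x ρ | ‖F y‖ ≤ 1 / 2} ∪ {y ∈ ball x ρ | 1 / 2 ≤ ‖F y‖}) := by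
        refine measureReal_mono (fun y hy => ?_) ?_
        · rcases le_total ‖F y‖ (1 / 2) with h | h
          · exact Or.inl ⟨hy, h⟩
          · exact Or.inr ⟨hy, h⟩
        · exact ne_top_of_le_ne_top measure_ball_lt_top.ne
            (measure_mono (union_subset (sep_subset _ _) (sep_subset _ _)))
      have h2 := measureReal_union_le (μ := volume) {y ∈ ball x ρ | ‖F y‖ ≤ 1 / 2}
        {y ∈ ball x ρ | 1 / 2 ≤ ‖F y‖}
      linarith
    rcases halt with halt | htop
    · refine hcond (fun y => 1 - ‖F y‖) (measurable_const.sub hFm.norm) (fun z y => ?_) ?_ ?_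
      · rw [sub_sub_sub_cancel_left, abs_sub_comm]
        exact abs_norm_sub_norm_le _ _
      · have h1 : volume.real ((ball x ρ ∩ O) \ (ball x r ∩ O))
            ≤ volume.real {y ∈ ball x ρ | 1 ≤ 1 - ‖F y‖} := by
          refine ENNReal.toReal_mono (hfin _) (measure_mono_ae ?_)
          filter_upwards [hFO] with y hy hyt
          refine ⟨hyt.1.1, ?_⟩
          rw [hy hyt.1.2, cutoff_eq_zero hδ fun h => hyt.2 ⟨h, hyt.1.2⟩]
          simp
        have h2 := le_measureReal_sdiff (μ := volume) (s₁ := ball x ρ ∩ O) (s₂ := ball x r ∩ O)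
          (ne_top_of_le_ne_top measure_ball_lt_top.ne (measure_mono inter_subset_left))
        rw [← hm_def] at h2
        linarith
      · convert hbig using 4
        constructor <;> rintro ⟨h1, h2⟩ <;> exact ⟨h1, by linarith⟩
    · have hball := volume_real_ball hd x hρ0.le
      rw [← hω] at hball
      have hmass : c' * (ρ ^ (d : ℝ) * ρ ^ (-e)) ≤ K * m * (r - t) ^ (-e) := by
        have hW : (1 / 2) ^ p * (9 ^ (-e) * ρ ^ (-e)) * (volume.real (ball x ρ) / 2)
            = c' * (ρ ^ (d : ℝ) * ρ ^ (-e)) := by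
          rw [hball, hc']; ring
        rw [← hW, ← ENNReal.ofReal_le_ofReal_iff hJ0]
        -- If `R = 1`, the Hardy weight may be small or vanish, but then `ρ = 1/8` and the plain
        -- `L^p` bound suffices, as `(9 ρ)^(-e) ≤ 1`.
        rcases le_total 1 (infEDist x D) with h1 | h1
        · rw [min_eq_left h1, ENNReal.ofReal_eq_one] at hRD
          refine le_trans ?_ hFp
          have := ofReal_mass_le_lintegral (w := fun _ => 1) hp hFm
            (by positivity : 0 ≤ 9 ^ (-e) * ρ ^ (-e)) measurableSet_ball (fun y _ => ?_) hbig
          · simpa using this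
          · rw [ENNReal.ofReal_le_one, ← Real.mul_rpow (by norm_num) hρ0.le]
            exact Real.rpow_le_one_of_one_le_of_nonpos (by rw [htop, hRD]; norm_num)
              (by linarith)
        · rw [min_eq_right h1] at hRD
          refine le_trans ?_ hFh
          refine ofReal_mass_le_lintegral hp hFm (by positivity) measurableSet_ball
            (fun y hy => ?_) hbig
          have h2 : infEDist y D ≤ ENNReal.ofReal (9 * ρ) := by
            calc infEDist y D ≤ infEDist x D + edist y x := infEDist_le_infEDist_add_edist
              _ ≤ ENNReal.ofReal R + ENNReal.ofReal ρ := by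
                  rw [hRD, edist_dist]
                  gcongr
                  exact (mem_ball.1 hy).le
              _ = ENNReal.ofReal (9 * ρ) := by
                  rw [← ENNReal.ofReal_add (by linarith) hρ0.le]
                  congr 1
                  linarith
          rw [← Real.mul_rpow (by norm_num) hρ0.le, ← ENNReal.ofReal_rpow_of_pos (by positivity),
            ENNReal.rpow_neg, ENNReal.rpow_neg, ENNReal.inv_le_inv]
          exact ENNReal.rpow_le_rpow h2 he.le
      refine (rpow_add_le_of_mass_bound hd0 hc'0 hδ (by linarith) hmass).trans ?_
      gcongr
      exact le_max_right _ _

end FracSobolev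

/-! ### Density of `O` at dyadic radii -/

namespace FracSobolev

variable {𝕜 : Type*} [RCLike 𝕜] {d : ℕ} {O D : Set (EuclideanSpace ℝ (Fin d))} {s p : ℝ}

section BallMeasure

variable (O) (x : EuclideanSpace ℝ (Fin d))

lemma volume_ball_inter_ne_top (r : ℝ) : volume (ball x r ∩ O) ≠ ∞ :=
  ne_top_of_le_ne_top measure_ball_lt_top.ne (measure_mono inter_subset_left)

lemma monotone_volume_real_ball_inter : Monotone fun r => volume.real (ball x r ∩ O) :=
  fun _ r h => measureReal_mono (inter_subset_inter_left _ (ball_subset_ball h))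
    (volume_ball_inter_ne_top O x r)

/-- The increments of this function are dominated by those of `|B(x,r)|`, because the measure of
`ball x r ∩ Oᶜ` is also monotone in `r`. -/
lemma continuous_volume_real_ball_inter (hd : 1 ≤ d) (hO : MeasurableSet O) :
    Continuous fun r => volume.real (ball x r ∩ O) := by
  set b : ℝ → ℝ := fun r => volume.real (ball x r) with hb
  have hbc : Continuous b := by
    have : b = fun r => (max r 0) ^ (d : ℝ)
        * volume.real (ball (0 : EuclideanSpace ℝ (Fin d)) 1) := by
      ext r
      rw [hb, ← volume_real_ball hd x (le_max_right r 0)]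
      rcases le_total r 0 with h | h
      · simp [max_eq_right h, ball_eq_empty.2 h]
      · simp [max_eq_left h]
    rw [this]
    exact ((continuous_id.max continuous_const).rpow_const
      fun _ => Or.inr (by positivity)).mul continuous_const
  have hsplit : ∀ r, volume.real (ball x r ∩ O) + volume.real (ball x r ∩ Oᶜ) = b r := fun r => by
    rw [← sdiff_eq, measureReal_inter_add_sdiff hO measure_ball_lt_top.ne]
  have hle : ∀ t r, t ≤ r →
      |volume.real (ball x r ∩ O) - volume.real (ball x t ∩ O)| ≤ |b r - b t| := by
    intro t r h
    have h1 := monotone_volume_real_ball_inter O x h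
    have h2 := monotone_volume_real_ball_inter Oᶜ x h
    have h3 := hsplit t
    have h4 := hsplit r
    simp only at h1 h2
    rw [abs_of_nonneg (by linarith), abs_of_nonneg (by linarith)]
    linarith
  refine continuous_iff_continuousAt.2 fun t => tendsto_iff_dist_tendsto_zero.2 ?_
  have h0 := tendsto_iff_dist_tendsto_zero.1 (hbc.tendsto t)
  refine squeeze_zero (fun _ => dist_nonneg) (fun r => ?_) h0
  rw [Real.dist_eq, Real.dist_eq]
  rcases le_total t r with h | h
  · exact hle t r h
  · rw [abs_sub_comm, abs_sub_comm (b r)]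
    exact hle r t h

lemma volume_real_ball_inter_pos {x : EuclideanSpace ℝ (Fin d)} (hO : IsOpen O)
    (hx : x ∈ closure O) {r : ℝ} (hr : 0 < r) : 0 < volume.real (ball x r ∩ O) := by
  obtain ⟨y, hyO, hy⟩ := mem_closure_iff.1 hx (ball x r) isOpen_ball (mem_ball_self hr)
  exact ENNReal.toReal_pos ((isOpen_ball.inter hO).measure_pos _ ⟨y, hyO, hy⟩).ne'
    (volume_ball_inter_ne_top O x r)

end BallMeasure

/-- The density bound at radius `σ`, provided that the measure doubles up to a radius `ρ ≤ 2 σ` or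
that `ρ` is comparable to the distance to `D`. -/
lemma AdmitsWholeSpaceExtensions.exists_density_bound (hd : 1 ≤ d) (hO : IsOpen O)
    (hp : 0 < p) (hs0 : 0 < s) (hs1 : s < 1) (hext : AdmitsWholeSpaceExtensions 𝕜 O D s p) :
    ∃ C : ℝ, 0 < C ∧ ∀ x ∈ closure O, ∀ R ρ σ : ℝ, R ≤ 1 →
      ENNReal.ofReal R = min 1 (infEDist x D) → 0 < σ → σ ≤ ρ → ρ ≤ 2 * σ → ρ ≤ R / 8 →
      (2 * volume.real (ball x σ ∩ O) ≤ volume.real (ball x ρ ∩ O) ∨ ρ = R / 8) →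
      σ ^ d ≤ C * volume.real (ball x σ ∩ O) := by
  have he : 0 < s * p := by positivity
  obtain ⟨C, hC0, hC⟩ := hext.exists_gap_bound hd hO.measurableSet hp hs0 hs1
  set q : ℝ := d + s * p with hq
  have hq0 : 0 < q := by positivity
  have hl1 : (2⁻¹ : ℝ) ^ q⁻¹ < 1 := Real.rpow_lt_one (by norm_num) (by norm_num) (by positivity)
  set A : ℝ := (1 - (2⁻¹ : ℝ) ^ q⁻¹)⁻¹ ^ q with hA
  have hA0 : 0 < A := Real.rpow_pos_of_pos (inv_pos.2 (by linarith)) _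
  refine ⟨A * C * 2 ^ (s * p), by positivity, ?_⟩
  intro x hx R ρ σ hR1 hRD hσ hσρ hρσ hρR halt
  have hmono := monotone_volume_real_ball_inter O x
  have hρ : 0 < ρ := hσ.trans_le hσρ
  have h1 := rpow_le_of_halving_gaps (A := C * ρ ^ (s * p)) hq0 (by positivity) hσ hmono
    (continuous_volume_real_ball_inter O x hd hO.measurableSet) (by simp)
    (fun r hr => volume_real_ball_inter_pos O hO hx hr)
    (fun t r ht htr hrσ h2 => by
      rw [mul_assoc]
      refine hC x R ρ r t hR1 hRD ht htr (hrσ.trans hσρ) hρR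
        (volume_real_ball_inter_pos O hO hx (ht.trans_lt htr)) h2
        -- Doubling between `σ` and `ρ` implies doubling between any smaller radius and `ρ`, so one
        -- `ρ` serves all gaps.
        (halt.imp_left fun h => le_trans ?_ h)
      have := hmono hrσ
      simp only at this
      linarith)
  have hρe : ρ ^ (s * p) ≤ 2 ^ (s * p) * σ ^ (s * p) := by
    rw [← Real.mul_rpow (by norm_num) hσ.le]
    exact Real.rpow_le_rpow hρ.le hρσ he.le
  rw [← Real.rpow_natCast]
  refine le_of_mul_le_mul_right ?_ (Real.rpow_pos_of_pos hσ (s * p))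
  rw [← Real.rpow_add hσ]
  calc σ ^ q ≤ A * (C * ρ ^ (s * p) * volume.real (ball x σ ∩ O)) := h1
    _ ≤ A * (C * (2 ^ (s * p) * σ ^ (s * p)) * volume.real (ball x σ ∩ O)) := by gcongr
    _ = _ := by ring

/-- The density bound at the radii `2⁻ⁿ R / 8`, with `R` the minimum of `1` and the distance
to `D`. -/
lemma dyadic_density_bound (hd : 1 ≤ d) {C R : ℝ} (hC : 0 < C) (hR : 0 < R)
    {x : EuclideanSpace ℝ (Fin d)}
    (h : ∀ ρ σ : ℝ, 0 < σ → σ ≤ ρ → ρ ≤ 2 * σ → ρ ≤ R / 8 →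
      (2 * volume.real (ball x σ ∩ O) ≤ volume.real (ball x ρ ∩ O) ∨ ρ = R / 8) →
      σ ^ d ≤ C * volume.real (ball x σ ∩ O)) (n : ℕ) :
    ((2⁻¹ : ℝ) ^ n * (R / 8)) ^ d ≤ C * volume.real (ball x ((2⁻¹ : ℝ) ^ n * (R / 8)) ∩ O) := by
  induction n with
  | zero =>
    rw [pow_zero, one_mul]
    exact h _ _ (by positivity) le_rfl (by linarith) le_rfl (Or.inr rfl)
  | succ n ih =>
    set ρ := (2⁻¹ : ℝ) ^ n * (R / 8) with hρ
    have hρ0 : 0 < ρ := by positivity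
    have hσ : (2⁻¹ : ℝ) ^ (n + 1) * (R / 8) = ρ / 2 := by rw [hρ, pow_succ]; ring
    rw [hσ]
    rcases le_or_gt (2 * volume.real (ball x (ρ / 2) ∩ O)) (volume.real (ball x ρ ∩ O))
      with hdbl | hdbl
    · refine h ρ (ρ / 2) (by positivity) (by linarith) (by linarith) ?_ (Or.inl hdbl)
      exact mul_le_of_le_one_left (by positivity) (pow_le_one₀ (by norm_num) (by norm_num))
    -- Halving the radius costs a factor `2` in measure but gains `2 ^ d ≥ 2`, so the constant `C`
    -- does not deteriorate along the induction.
    · have h2 : (2 : ℝ) ≤ 2 ^ d := le_self_pow₀ (by norm_num) (by omega)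
      rw [div_pow, div_le_iff₀ (by positivity)]
      calc ρ ^ d ≤ C * volume.real (ball x ρ ∩ O) := ih
        _ ≤ C * (2 * volume.real (ball x (ρ / 2) ∩ O)) := by gcongr
        _ = C * volume.real (ball x (ρ / 2) ∩ O) * 2 := by ring
        _ ≤ _ := by gcongr

end FracSobolev

/-! ### The thickness condition -/

theorem proposition4p3 {𝕜 : Type*} [RCLike 𝕜] (d : ℕ)
    (O D : Set (EuclideanSpace ℝ (Fin d))) (hO : IsOpen O) (hD : D ⊆ frontier O)
    (p s : ℝ) (hp : 0 < p) (hs0 : 0 < s) (hs1 : s < 1)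
    (hext : FracSobolev.AdmitsWholeSpaceExtensions 𝕜 O D s p) :
    FracSobolev.DegenerateInteriorThick O (frontier O \ D) := by
  refine ⟨hO, sdiff_subset, ?_⟩
  rw [sdiff_sdiff_cancel_left hD]
  rcases Nat.eq_zero_or_pos d with rfl | hd
  -- In dimension `0` the space is discrete and `frontier O` is empty.
  · refine ⟨1, one_pos, fun x hx => ?_⟩
    rw [(isClopen_discrete O).frontier_eq] at hx
    exact absurd hx.1 (notMem_empty x)
  obtain ⟨C, hC0, hC⟩ := hext.exists_density_bound hd hO hp hs0 hs1
  set ω := volume.real (ball (0 : EuclideanSpace ℝ (Fin d)) 1) with hω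
  have hω0 : 0 < ω := volume_real_unitBall_pos
  have hc0 : 0 < (16 ^ d * C * ω)⁻¹ := by positivity
  refine ⟨(16 ^ d * C * ω)⁻¹.toNNReal, Real.toNNReal_pos.2 hc0, fun x hx r hr => ?_⟩
  rcases le_or_gt r 0 with hr0 | hr0
  · simp [ball_eq_empty.2 hr0]
  set R : ℝ := (min 1 (infEDist x D)).toReal with hR
  have hfin : min 1 (infEDist x D) ≠ ∞ := ne_top_of_le_ne_top ENNReal.one_ne_top (min_le_left _ _)
  have hRD : ENNReal.ofReal R = min 1 (infEDist x D) := ENNReal.ofReal_toReal hfin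
  have hR1 : R ≤ 1 := ENNReal.toReal_mono ENNReal.one_ne_top (min_le_left _ _)
  have hrR : r ≤ R := (ENNReal.ofReal_le_iff_le_toReal hfin).1 hr
  have hR0 : 0 < R := hr0.trans_le hrR
  -- With `2⁻⁽ⁿ⁺¹⁾ R < r ≤ 2⁻ⁿ R`, the radius `σ = 2⁻⁽ⁿ⁺¹⁾ R / 8` satisfies `σ ≤ r ≤ 16 σ`, whence
  -- the `16 ^ d`.
  obtain ⟨n, hn1, hn2⟩ := exists_nat_pow_near_of_lt_one (div_pos hr0 hR0)
    ((div_le_one hR0).2 hrR) (by norm_num : (0 : ℝ) < 2⁻¹) (by norm_num)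
  have hσ := FracSobolev.dyadic_density_bound hd hC0 hR0
    (fun ρ σ => hC x (frontier_subset_closure hx.1) R ρ σ hR1 hRD) (n + 1)
  set σ : ℝ := (2⁻¹ : ℝ) ^ (n + 1) * (R / 8) with hσ_def
  have hσ0 : 0 < σ := by positivity
  rw [lt_div_iff₀ hR0] at hn1
  rw [div_le_iff₀ hR0] at hn2
  have hσr : σ ≤ r := by
    rw [hσ_def]
    linarith
  have hrσ : r ≤ 16 * σ := by
    rw [hσ_def, pow_succ]
    linarith
  have hreal : (16 ^ d * C * ω)⁻¹ * volume.real (ball x r) ≤ volume.real (ball x r ∩ O) := by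
    rw [volume_real_ball hd x hr0.le, Real.rpow_natCast, inv_mul_le_iff₀ (by positivity), ← hω]
    calc r ^ d * ω ≤ (16 * σ) ^ d * ω := by gcongr
      _ = 16 ^ d * σ ^ d * ω := by rw [mul_pow]
      _ ≤ 16 ^ d * (C * volume.real (ball x σ ∩ O)) * ω := by gcongr
      _ ≤ 16 ^ d * (C * volume.real (ball x r ∩ O)) * ω := by
          have := FracSobolev.monotone_volume_real_ball_inter O x hσr
          gcongr
      _ = _ := by ring
  rw [← ENNReal.ofReal_toReal (FracSobolev.volume_ball_inter_ne_top O x r),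
    ← ENNReal.ofReal_toReal (measure_ball_lt_top (μ := volume) (x := x) (r := r)).ne,
    ← ENNReal.ofReal, ← ENNReal.ofReal_mul hc0.le]
  exact ENNReal.ofReal_le_ofReal hreal
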